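/- Consider the activated random walk (ARW) on $\mathbb Z$ with sleeping rate $\lambda\in(0,\infty]$ and nearest-neighbour jump distribution $p$ (a probability on $\mathbb Z$ with $p(z)=0$ unless $|z|=1$; bias, including total asymmetry, is allowed). The state $\eta_t(x)$ of a site $x\in\mathbb Z$ at time $t\ge 0$ is either a number $n\in\mathbb N_0$ of active particles or $\varrho$ (one passive particle), with $\varrho+1=2$ when a particle arrives. For $\lambda<\infty$, site $x$ rings at rate $(1+\lambda)$ times the number of active particles at $x$; at a ring, with probability $\frac{\lambda}{1+\lambda}$ a sleep attempt is made (turning $1$ into $\varrho$ and leaving $n\ge 2$ unchanged), and with probability $\frac{p(z)}{1+\lambda}$ one active particle jumps from $x$ to $x+z$. For $\lambda=\infty$, an active particle that is alone at its site becomes passive instantaneously, and site $x$ rings at rate equal to the number of active particles at $x$, each ring making one of them jump from $x$ to $x+z$ with probability $p(z)$. The process is realised site-wise: the initial configuration, the i.i.d. instructions $(\tau^{x,j})_{x,j}$ and i.i.d. rate-one exponential variables are independent, and the $j$-th ring of $x$ occurs, and uses $\tau^{x,j}$, when the internal clock of $x$, which runs at the above rate, reaches the sum of the first $j$ exponential variables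 of $x$. Initially all particles are active (for $\lambda=\infty$ those that are alone at once become passive) and their numbers at the sites are i.i.d. Poisson with mean $\mu$. The system locally fixates if, for each $x\in\mathbb Z$, $\eta_t(x)$ is eventually constant in $t$. Theorem. If $\mu=1$, then for every $\lambda\in(0,\infty]$ and every such $p$, the ARW does not fixate: almost surely $(\eta_t)_{t\ge 0}$ does not locally fixate, i.e. $\mathbb P(\text{fixation})=0$. -/

import Mathlib

open MeasureTheory ProbabilityTheory Filter Topology
open scoped NNReal ENNReal

/-- The state of a site: `active n` is `n` active particles (`n = 0` is the empty site),
`passive` is one passive particle (written `ϱ` below). -/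
inductive SiteState where
  | active (n : ℕ)
  | passive

namespace SiteState

/-- The number of active particles. -/
def numActive : SiteState → ℕ
  | active n => n
  | passive => 0

/-- Adding a particle; in particular `ϱ + 1 = 2`. -/
def addParticle : SiteState → SiteState
  | active n => active (n + 1)
  | passive => active 2

/-- Removing a particle (only used at sites with an active particle). -/
def removeParticle : SiteState → SiteState
  | active n => active (n - 1)
  | passive => active 0

/-- An attempt to sleep: it succeeds exactly when the particle is alone,
`1 ⬝ ϱ = ϱ` and `n ⬝ ϱ = n` for `n ≥ 2`. -/
def trySleep : SiteState → SiteState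
  | active 1 => passive
  | s => s

end SiteState

/-- A configuration on `ℤ`. -/
abbrev Config : Type := ℤ → SiteState

/-- The instruction used by one toppling: jump with displacement `z`, or try to sleep. -/
inductive Instr where
  | jump (z : ℤ)
  | sleep

instance : MeasurableSpace Instr := ⊤

/-- The rate of the exponential clock by which an active particle attempts to sleep.
For `lam = ∞` no such clock is needed, since a lone active particle falls asleep
instantaneously (see `settle`) and attempts in company have no effect. -/
noncomputable def sleepClockRate (lam : ℝ≥0∞) : ℝ≥0∞ := if lam = ∞ then 0 else lam

/-- For sleeping rate `lam = ∞`, a lone active particle becomes passive instantaneously.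
For `lam < ∞` nothing happens instantaneously. -/
noncomputable def settle (lam : ℝ≥0∞) (s : SiteState) : SiteState :=
  if lam = ∞ then s.trySleep else s

/-- The effect on a configuration of a toppling of `x` with a given instruction. -/
noncomputable def applyInstr (x : ℤ) (ζ : Config) : Instr → Config
  | Instr.jump z =>
      let ζ' := Function.update ζ x (ζ x).removeParticle
      Function.update ζ' (x + z) (ζ' (x + z)).addParticle
  | Instr.sleep => Function.update ζ x (ζ x).trySleep

/-- The time shown at time `t` by the internal clock of site `x`, which runs at speed
`(1 + lam) * (number of active particles at x)`, respectively at speed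
`(number of active particles at x)` when `lam = ∞`. -/
noncomputable def internalTime (lam : ℝ≥0∞) (η : ℝ → Config) (x : ℤ) (t : ℝ) : ℝ≥0∞ :=
  ∫⁻ s in Set.Ioc 0 t, (1 + sleepClockRate lam) * ((η s x).numActive : ℝ≥0∞)

/-- `η` (with `h t x` the number of topplings of `x` during `[0, t]`) is a trajectory on the
time axis `t ≥ 0` of the activated random walk dynamics on `ℤ` with sleeping rate `lam`,
started with `η₀ x` active particles at each `x`. The `j`-th toppling of `x` (counting from `0`)
takes place when the internal clock of `x` shows
`clock x 0 + ⋯ + clock x j`, and it uses the instruction `instr x j`. -/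
structure IsARWTrajectory (lam : ℝ≥0∞) (η₀ : ℤ → ℕ) (instr : ℤ → ℕ → Instr)
    (clock : ℤ → ℕ → ℝ) (η : ℝ → Config) (h : ℝ → ℤ → ℕ) : Prop where
  init : ∀ x, η 0 x = settle lam (SiteState.active (η₀ x)) ∧ h 0 x = 0
  /-- The clock of `x` has rung more than `j` times iff its internal time is past its
  `j`-th ring. -/
  ring : ∀ t, 0 ≤ t → ∀ x j, j < h t x ↔
    ENNReal.ofReal (∑ i ∈ Finset.range (j + 1), clock x i) ≤ internalTime lam η x t
  right_cont : ∀ t, 0 ≤ t → ∀ x, ∀ᶠ s in 𝓝[>] t, η s x = η t x ∧ h s x = h t x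
  /-- At every time `t > 0` there are left limits `(ζ, k)` and either nothing happens or
  exactly one unstable site topples. -/
  step : ∀ t, 0 < t → ∃ (ζ : Config) (k : ℤ → ℕ),
    (∀ x, ∀ᶠ s in 𝓝[<] t, η s x = ζ x ∧ h s x = k x) ∧
    ((η t = ζ ∧ h t = k) ∨
      ∃ x, 1 ≤ (ζ x).numActive ∧
        η t = (fun y => settle lam (applyInstr x ζ (instr x (k x)) y)) ∧
        h t = Function.update k x (k x + 1))

/-- The process `η` on the probability space `(Ω, P)` is an activated random walk on `ℤ` with
sleeping rate `lam`, jump distribution `p` and i.i.d. Poisson initial condition of mean `μ`: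
the initial particle numbers are i.i.d. Poisson, each ring of a site's clock comes after an
independent unit exponential amount of internal time, and at each ring an independent
instruction is used, which is to sleep with probability `lam / (1 + lam)` and to jump by `z`
with probability `p z / (1 + lam)` (for `lam = ∞`: to jump by `z` with probability `p z`). -/
structure IsPoissonARW {Ω : Type*} [MeasurableSpace Ω] (P : Measure Ω)
    (lam : ℝ≥0∞) (p : PMF ℤ) (μ : ℝ≥0)
    (η₀ : ℤ → Ω → ℕ) (instr : ℤ → ℕ → Ω → Instr) (clock : ℤ → ℕ → Ω → ℝ)
    (η : ℝ → Ω → Config) : Prop where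
  meas_init : ∀ x, Measurable (η₀ x)
  law_init : ∀ x, P.map (η₀ x) = poissonMeasure μ
  indep_init : iIndepFun η₀ P
  meas_instr : ∀ x j, Measurable (instr x j)
  law_jump : ∀ x j z, P {ω | instr x j ω = Instr.jump z} = p z / (1 + sleepClockRate lam)
  law_sleep : ∀ x j,
    P {ω | instr x j ω = Instr.sleep} = sleepClockRate lam / (1 + sleepClockRate lam)
  indep_instr : iIndepFun (fun a : ℤ × ℕ => instr a.1 a.2) P
  meas_clock : ∀ x j, Measurable (clock x j)
  law_clock : ∀ x j, P.map (clock x j) = expMeasure 1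
  indep_clock : iIndepFun (fun a : ℤ × ℕ => clock a.1 a.2) P
  indep_instr_clock :
    IndepFun (fun ω x j => instr x j ω) (fun ω x j => clock x j ω) P
  indep_init_rest :
    IndepFun (fun ω x => η₀ x ω)
      (fun ω => ((fun x j => instr x j ω : ℤ → ℕ → Instr),
        (fun x j => clock x j ω : ℤ → ℕ → ℝ))) P
  trajectory : ∀ᵐ ω ∂P, ∃ h : ℝ → ℤ → ℕ,
    IsARWTrajectory lam (fun x => η₀ x ω) (fun x j => instr x j ω) (fun x j => clock x j ω)
      (fun t => η t ω) h

/-- Local fixation: the state of each site is eventually constant in time. -/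
def LocallyFixates (η : ℝ → Config) : Prop :=
  ∀ x, ∃ T, 0 ≤ T ∧ ∀ t, T ≤ t → η t x = η T x

/-! Suppose that a realisation fixates. Every site is then toppled finitely often and ends with at
most one particle, so conservation of particles turns the final odometer into a function `m` with
`LeavesAtMostOne`. Summing this condition over a block of `n` sites cancels the inner edges: the
initial number of particles in the block is at most `n` plus the values of `m` at its two end sites
(`LeavesAtMostOne.block_sum_le`).

At density one this bound is too restrictive. By the central limit theorem a long block has an
excess of order `√n` with probability at least some `δ > 0`, so for any `M` suitable blocks have
excess `2 * M` with that probability, which forces `m ≥ M` at an end site. A stationary odometer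
that is finite, hence tight, cannot allow this in many independent blocks.

For stationarity the final odometer is replaced by the least one that leaves at most one particle
per site. It is the limit `stabSup` of an explicit iteration, hence a measurable and translation
covariant function of the initial configuration and the instructions alone; the clocks and the
trajectory no longer enter. With `K` independent blocks, P(fixation) ≤ (1 - δ)^K + 2K · P(M ≤
`stabSup` < ∞ at a site). Letting first `M` and then `K` tend to infinity gives zero. No ergodicity
or zero-one law is needed. -/

/-! ### Particle number of a site -/

/-- The number of particles at a site, active or not. -/
def SiteState.mass : SiteState → ℕ
  | active n => n
  | passive => 1

namespace SiteState

lemma mass_trySleep (s : SiteState) : s.trySleep.mass = s.mass := by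
  rcases s with n | _
  · by_cases h : n = 1
    · subst h; rfl
    · simp [trySleep, h]
  · rfl

lemma mass_addParticle (s : SiteState) : s.addParticle.mass = s.mass + 1 := by
  cases s <;> rfl

lemma mass_removeParticle {s : SiteState} (hs : 1 ≤ s.numActive) :
    s.removeParticle.mass + 1 = s.mass := by
  rcases s with n | _
  · simp only [numActive] at hs
    simp only [removeParticle, mass]
    omega
  · simp [numActive] at hs

end SiteState

lemma mass_settle (lam : ℝ≥0∞) (s : SiteState) : (settle lam s).mass = s.mass := by
  unfold settle
  split_ifs
  · exact s.mass_trySleep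
  · rfl

/-! ### Odometers and the flow of particles -/

open Classical in
/-- The number of jumps by `z` among the first `n` instructions of the stack `s`. -/
noncomputable def jumpCount (z : ℤ) (s : ℕ → Instr) (n : ℕ) : ℕ :=
  ∑ i ∈ Finset.range n, if s i = Instr.jump z then 1 else 0

@[simp] lemma jumpCount_zero (z : ℤ) (s : ℕ → Instr) : jumpCount z s 0 = 0 := by
  simp [jumpCount]

open Classical in
lemma jumpCount_succ (z : ℤ) (s : ℕ → Instr) (n : ℕ) :
    jumpCount z s (n + 1) = jumpCount z s n + if s n = Instr.jump z then 1 else 0 := by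
  simp only [jumpCount, Finset.sum_range_succ]

lemma jumpCount_mono (z : ℤ) (s : ℕ → Instr) : Monotone (jumpCount z s) :=
  monotone_nat_of_le_succ fun n => by rw [jumpCount_succ]; omega

lemma jumpCount_le (z : ℤ) (s : ℕ → Instr) (n : ℕ) : jumpCount z s n ≤ n := by
  induction n with
  | zero => simp
  | succ n ih => rw [jumpCount_succ]; split_ifs <;> omega

/-- The number of particles initially at `x` or having jumped to `x` when every site `y` has
used the first `m y` of its nearest-neighbour instructions. -/
noncomputable def inflow (e : ℤ → ℕ) (τ : ℤ → ℕ → Instr) (m : ℤ → ℕ) (x : ℤ) : ℕ :=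
  e x + jumpCount 1 (τ (x - 1)) (m (x - 1)) + jumpCount (-1) (τ (x + 1)) (m (x + 1))

/-- The number of nearest-neighbour jumps among the first `n` instructions of a stack. -/
noncomputable def outflow (s : ℕ → Instr) (n : ℕ) : ℕ := jumpCount 1 s n + jumpCount (-1) s n

lemma inflow_mono (e : ℤ → ℕ) (τ : ℤ → ℕ → Instr) {m m' : ℤ → ℕ} (h : m ≤ m') (x : ℤ) :
    inflow e τ m x ≤ inflow e τ m' x := by
  unfold inflow
  gcongr
  · exact jumpCount_mono _ _ (h _)
  · exact jumpCount_mono _ _ (h _)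

/-- Toppling every site `x` exactly `m x` times leaves at most one particle per site. -/
def LeavesAtMostOne (e : ℤ → ℕ) (τ : ℤ → ℕ → Instr) (m : ℤ → ℕ) : Prop :=
  ∀ x, inflow e τ m x ≤ outflow (τ x) (m x) + 1

/-- Jumps across inner edges of the block cancel on summation. What leaves the block does so to the
right from its last site or to the left from its first, and each number of jumps is at most the
odometer there. -/
lemma LeavesAtMostOne.block_sum_le {e : ℤ → ℕ} {τ : ℤ → ℕ → Instr} {m : ℤ → ℕ}
    (hm : LeavesAtMostOne e τ m) (a : ℤ) (n : ℕ) :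
    ∑ k ∈ Finset.range n, e (a + k) ≤ n + m (a + n - 1) + m a := by
  -- The inflow through both ends is kept on the left, as the induction needs it to cancel the flow
  -- through the next edge; it is dropped afterwards.
  have key : ∀ n : ℕ,
      ∑ k ∈ Finset.range n, e (a + k) + jumpCount 1 (τ (a - 1)) (m (a - 1))
          + jumpCount (-1) (τ (a + n)) (m (a + n))
        ≤ n + jumpCount 1 (τ (a + n - 1)) (m (a + n - 1)) + jumpCount (-1) (τ a) (m a) := by
    intro n
    induction n with
    | zero => simp
    | succ n ih =>
      have h := hm (a + n)
      simp only [inflow, outflow] at h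
      rw [Finset.sum_range_succ]
      push_cast
      have h1 : a + ((n : ℤ) + 1) - 1 = a + n := by ring
      rw [h1, ← add_assoc]
      omega
  have h1 := jumpCount_le 1 (τ (a + n - 1)) (m (a + n - 1))
  have h2 := jumpCount_le (-1) (τ a) (m a)
  have := key n
  omega

/-! ### The least odometer -/

/-- Monotone approximations of the least odometer that leaves at most one particle per site. -/
noncomputable def stabIter (e : ℤ → ℕ) (τ : ℤ → ℕ → Instr) : ℕ → ℤ → ℕ
  | 0, _ => 0
  | k + 1, x => sInf {j | inflow e τ (stabIter e τ k) x ≤ outflow (τ x) j + 1}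

lemma stabIter_shift (e : ℤ → ℕ) (τ : ℤ → ℕ → Instr) (a : ℤ) (k : ℕ) (x : ℤ) :
    stabIter (fun y => e (a + y)) (fun y => τ (a + y)) k x = stabIter e τ k (a + x) := by
  induction k generalizing x with
  | zero => rfl
  | succ k ih =>
    simp only [stabIter, inflow, ih, add_sub_assoc, add_assoc]

section
variable {e : ℤ → ℕ} {τ : ℤ → ℕ → Instr} {m : ℤ → ℕ}

lemma LeavesAtMostOne.stabIter_le (hm : LeavesAtMostOne e τ m) (k : ℕ) : stabIter e τ k ≤ m := by
  induction k with
  | zero => intro x; exact Nat.zero_le _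
  | succ k ih => exact fun x => Nat.sInf_le ((inflow_mono e τ ih x).trans (hm x))

/-- The existence of `m` makes the set in `stabIter` nonempty, so its infimum is attained and is not
the default value `0`. -/
lemma LeavesAtMostOne.inflow_stabIter_le (hm : LeavesAtMostOne e τ m) (k : ℕ) (x : ℤ) :
    inflow e τ (stabIter e τ k) x ≤ outflow (τ x) (stabIter e τ (k + 1) x) + 1 :=
  Nat.sInf_mem (s := {j | inflow e τ (stabIter e τ k) x ≤ outflow (τ x) j + 1})
    ⟨m x, (inflow_mono e τ (hm.stabIter_le k) x).trans (hm x)⟩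

lemma LeavesAtMostOne.stabIter_mono (hm : LeavesAtMostOne e τ m) : Monotone (stabIter e τ) := by
  refine monotone_nat_of_le_succ fun k => ?_
  induction k with
  | zero => intro x; exact Nat.zero_le _
  | succ k ih =>
    exact fun x => Nat.sInf_le ((inflow_mono e τ ih x).trans (hm.inflow_stabIter_le (k + 1) x))

/-- If some odometer leaves at most one particle per site, then so does the limit of `stabIter`. -/
lemma LeavesAtMostOne.exists_limit (hm : LeavesAtMostOne e τ m) :
    ∃ m', LeavesAtMostOne e τ m' ∧ ∀ x, ⨆ k, (stabIter e τ k x : ℝ≥0∞) = m' x := by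
  have hmono := hm.stabIter_mono
  have hev : ∀ x, ∃ n K, ∀ k, K ≤ k → stabIter e τ k x = n := by
    intro x
    have hb : BddAbove (Set.range fun k => stabIter e τ k x) :=
      ⟨m x, by rintro _ ⟨k, rfl⟩; exact hm.stabIter_le k x⟩
    obtain ⟨K, hK⟩ := Nat.sSup_mem (Set.range_nonempty _) hb
    refine ⟨_, K, fun k hk => le_antisymm (le_csSup hb ⟨k, rfl⟩) ?_⟩
    rw [← hK]
    exact hmono hk x
  choose m' K hK using hev
  refine ⟨m', fun x => ?_, fun x => le_antisymm (iSup_le fun k => ?_) ?_⟩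
  -- The condition at `x` involves only three sites, so it passes to the limit at a stage where all
  -- three have stabilised.
  · set k := max (K x) (max (K (x - 1)) (K (x + 1)))
    have h := hm.inflow_stabIter_le k x
    simp only [inflow] at h ⊢
    rw [hK x (k + 1) (by omega), hK (x - 1) k (by omega), hK (x + 1) k (by omega)] at h
    exact h
  · rw [← hK x (max k (K x)) (le_max_right _ _)]
    exact_mod_cast hmono (le_max_left k (K x)) x
  · rw [← hK x (K x) le_rfl]
    exact le_iSup (fun k => (stabIter e τ k x : ℝ≥0∞)) (K x)

end

/-! ### Trajectories that fixate -/

/-- Induction over `[a, ∞)` along a predicate that extends to the right and passes to the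
right end of half-open intervals. -/
lemma real_induction {a : ℝ} {p : ℝ → Prop} (h0 : p a)
    (hr : ∀ t, a ≤ t → p t → ∀ᶠ s in 𝓝[>] t, p s)
    (hl : ∀ t, a < t → (∀ s, a ≤ s → s < t → p s) → p t) (t : ℝ) (ht : a ≤ t) : p t := by
  by_contra hpt
  set B : Set ℝ := {s | a ≤ s ∧ ¬ p s}
  have hB : B.Nonempty := ⟨t, ht, hpt⟩
  have hbdd : BddBelow B := ⟨a, fun s hs => hs.1⟩
  have ha : a ≤ sInf B := le_csInf hB fun s hs => hs.1
  have hlt : ∀ s, a ≤ s → s < sInf B → p s := fun s h1 h2 => by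
    by_contra h3
    exact absurd (csInf_le hbdd ⟨h1, h3⟩) (not_le.2 h2)
  have hp : p (sInf B) := by
    rcases ha.eq_or_lt with h | h
    · rwa [← h]
    · exact hl _ h hlt
  obtain ⟨u, hu, hup⟩ := mem_nhdsGT_iff_exists_Ioo_subset.1 (hr _ ha hp)
  obtain ⟨b, hb, hbu⟩ := exists_lt_of_csInf_lt hB hu
  rcases (csInf_le hbdd hb).eq_or_lt with h | h
  · exact hb.2 (h ▸ hp)
  · exact hb.2 (hup ⟨h, hbu⟩)

namespace IsARWTrajectory

variable {lam : ℝ≥0∞} {e : ℤ → ℕ} {τ : ℤ → ℕ → Instr} {clock : ℤ → ℕ → ℝ} {η : ℝ → Config}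
  {h : ℝ → ℤ → ℕ}

lemma odometer_mono (H : IsARWTrajectory lam e τ clock η h) (x : ℤ) {s t : ℝ} (hs : 0 ≤ s)
    (hst : s ≤ t) : h s x ≤ h t x := by
  refine le_of_forall_lt fun j hj => ?_
  rw [H.ring t (hs.trans hst)]
  refine ((H.ring s hs x j).1 hj).trans ?_
  exact lintegral_mono_set (Set.Ioc_subset_Ioc_right hst)

lemma jumpCount_update (z : ℤ) (τ : ℤ → ℕ → Instr) (k : ℤ → ℕ) (y x : ℤ)
    [Decidable (x = y ∧ τ y (k y) = Instr.jump z)] :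
    jumpCount z (τ x) (Function.update k y (k y + 1) x) =
      jumpCount z (τ x) (k x) + if x = y ∧ τ y (k y) = Instr.jump z then 1 else 0 := by
  rcases eq_or_ne x y with rfl | hxy
  · simp only [Function.update_self, jumpCount_succ, true_and]
    congr 2
    simp
  · simp [hxy]

lemma mass_applyInstr_jump {ζ : Config} {y z : ℤ} (hz : z ≠ 0) (hy : 1 ≤ (ζ y).numActive) (x : ℤ) :
    (applyInstr y ζ (Instr.jump z) x).mass + (if x = y then 1 else 0) =
      (ζ x).mass + if x = y + z then 1 else 0 := by
  have hrem := SiteState.mass_removeParticle hy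
  have hyz : y + z ≠ y := by omega
  rcases eq_or_ne x y with rfl | hxy
  · simp [applyInstr, hyz.symm, hrem]
  · rcases eq_or_ne x (y + z) with rfl | hxz
    · simp [applyInstr, hz, SiteState.mass_addParticle]
    · simp [applyInstr, hxy, hxz]

lemma mass_applyInstr_sleep (ζ : Config) (y x : ℤ) :
    (applyInstr y ζ Instr.sleep x).mass = (ζ x).mass := by
  rcases eq_or_ne x y with rfl | hxy
  · simp [applyInstr, SiteState.mass_trySleep]
  · simp [applyInstr, hxy]

open Classical in
/-- Conservation of particles under a toppling. -/
lemma mass_applyInstr (hτ : ∀ x j z, τ x j = Instr.jump z → z = 1 ∨ z = -1) {ζ : Config}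
    {k : ℤ → ℕ} {y : ℤ} (hy : 1 ≤ (ζ y).numActive) (x : ℤ)
    (hζ : (ζ x).mass + outflow (τ x) (k x) = inflow e τ k x) :
    (applyInstr y ζ (τ y (k y)) x).mass + outflow (τ x) (Function.update k y (k y + 1) x) =
      inflow e τ (Function.update k y (k y + 1)) x := by
  have h11 : Instr.jump 1 ≠ Instr.jump (-1) := by simp
  unfold inflow outflow at *
  simp only [jumpCount_update]
  rcases hi : τ y (k y) with z | _
  · rcases hτ y (k y) z hi with rfl | rfl
    · have := mass_applyInstr_jump (z := 1) (by norm_num) hy x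
      simp only [h11, and_true, and_false, if_false, sub_eq_iff_eq_add] at *
      split_ifs at * <;> omega
    · have := mass_applyInstr_jump (z := -1) (by norm_num) hy x
      simp only [h11.symm, and_true, and_false, if_false, ← eq_sub_iff_add_eq, ← sub_eq_add_neg]
        at *
      split_ifs at * <;> omega
  · simpa [mass_applyInstr_sleep] using hζ

/-- Conservation of particles along a trajectory. -/
lemma mass_add_outflow (H : IsARWTrajectory lam e τ clock η h)
    (hτ : ∀ x j z, τ x j = Instr.jump z → z = 1 ∨ z = -1) (x : ℤ) (t : ℝ) (ht : 0 ≤ t) :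
    (η t x).mass + outflow (τ x) (h t x) = inflow e τ (h t) x := by
  have hcongr : ∀ {s s' : Config} {k k' : ℤ → ℕ}, s x = s' x → k x = k' x →
      k (x - 1) = k' (x - 1) → k (x + 1) = k' (x + 1) →
      ((s x).mass + outflow (τ x) (k x) = inflow e τ k x ↔
        (s' x).mass + outflow (τ x) (k' x) = inflow e τ k' x) := by
    intro s s' k k' h1 h2 h3 h4
    unfold inflow
    rw [h1, h2, h3, h4]
  refine real_induction (a := 0)
    (p := fun t => (η t x).mass + outflow (τ x) (h t x) = inflow e τ (h t) x) ?_ ?_ ?_ t ht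
  · have h1 : (SiteState.active (e x)).mass = e x := rfl
    simp [inflow, outflow, (H.init _).1, (H.init _).2, mass_settle, h1]
  · intro t ht hp
    filter_upwards [H.right_cont t ht x, H.right_cont t ht (x - 1), H.right_cont t ht (x + 1)]
      with s h1 h2 h3
    exact (hcongr h1.1 h1.2 h2.2 h3.2).2 hp
  · intro t ht hlt
    obtain ⟨ζ, k, hlim, hstep⟩ := H.step t ht
    have hζ : (ζ x).mass + outflow (τ x) (k x) = inflow e τ k x := by
      have hIoo : ∀ᶠ s in 𝓝[<] t, s ∈ Set.Ioo 0 t := Ioo_mem_nhdsLT ht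
      obtain ⟨s, h1, h2, h3, hs⟩ :=
        ((hlim x).and ((hlim (x - 1)).and ((hlim (x + 1)).and hIoo))).exists
      exact (hcongr h1.1 h1.2 h2.2 h3.2).1 (hlt s hs.1.le hs.2)
    rcases hstep with ⟨h1, h2⟩ | ⟨y, hy, h1, h2⟩
    · rwa [h1, h2]
    · rw [h1, h2, mass_settle]
      exact mass_applyInstr hτ hy x hζ

/-- While the state of `x` does not change, `x` does not use a jump instruction. -/
lemma odometer_le_of_jump (H : IsARWTrajectory lam e τ clock η h)
    (hτ : ∀ x j z, τ x j = Instr.jump z → z = 1 ∨ z = -1) {x : ℤ} {T : ℝ} (hT : 0 ≤ T)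
    (hfix : ∀ t, T ≤ t → η t x = η T x) {j : ℕ} {z : ℤ} (hj : τ x j = Instr.jump z)
    (hTj : h T x ≤ j) (t : ℝ) (ht : T ≤ t) : h t x ≤ j := by
  refine real_induction (p := fun t => h t x ≤ j) hTj ?_ ?_ t ht
  · intro t ht hp
    filter_upwards [H.right_cont t (hT.trans ht) x] with s hs
    rwa [hs.2]
  · intro t ht hlt
    obtain ⟨ζ, k, hlim, hstep⟩ := H.step t (hT.trans_lt ht)
    have hIoo : ∀ᶠ s in 𝓝[<] t, s ∈ Set.Ioo T t := Ioo_mem_nhdsLT ht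
    obtain ⟨s, h1, hs⟩ := ((hlim x).and hIoo).exists
    have hk : k x ≤ j := h1.2 ▸ hlt s hs.1.le hs.2
    rcases hstep with ⟨_, h2⟩ | ⟨y, hy, h2, h3⟩
    · rwa [h2]
    · rw [h3]
      rcases eq_or_ne x y with rfl | hxy
      · rcases hk.lt_or_eq with hk | hk
        · simpa using hk
        -- Here `x` would execute the jump `j` at time `t`, lowering its particle number by one
        -- although its state is constant from `T` on.
        · exfalso
          have hz : z ≠ 0 := by rcases hτ x j z hj with rfl | rfl <;> norm_num
          have h4 : η t x = ζ x := by rw [hfix t ht.le, ← hfix s hs.1.le, h1.1]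
          have h5 := mass_applyInstr_jump hz hy x
          rw [h2, hk, hj] at h4
          have h6 := congrArg SiteState.mass h4
          rw [mass_settle] at h6
          simp [hz] at h5
          omega
      · simpa [hxy] using hk

lemma internalTime_eq (T t : ℝ) (hT : 0 ≤ T) (ht : T ≤ t) (x : ℤ)
    (hfix : ∀ t, T ≤ t → η t x = η T x) :
    internalTime lam η x t = internalTime lam η x T +
      (1 + sleepClockRate lam) * ((η T x).numActive : ℝ≥0∞) * ENNReal.ofReal (t - T) := by
  unfold internalTime
  rw [← Set.Ioc_union_Ioc_eq_Ioc hT ht,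
    lintegral_union measurableSet_Ioc (Set.Ioc_disjoint_Ioc_of_le le_rfl)]
  congr 1
  rw [setLIntegral_congr_fun (g := fun _ => (1 + sleepClockRate lam) * ((η T x).numActive : ℝ≥0∞))
    measurableSet_Ioc (fun s hs => by simp only [hfix s hs.1.le])]
  simp

/-- A site whose state is eventually constant carries at most one particle in the limit and is
toppled finitely often. -/
lemma site_fixates (H : IsARWTrajectory lam e τ clock η h)
    (hτ : ∀ x j z, τ x j = Instr.jump z → z = 1 ∨ z = -1)
    {x : ℤ} (hinf : ∀ J, ∃ j ≥ J, ∃ z, τ x j = Instr.jump z)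
    {T : ℝ} (hT : 0 ≤ T) (hfix : ∀ t, T ≤ t → η t x = η T x) :
    (η T x).mass ≤ 1 ∧ ∀ t, T ≤ t → h t x = h T x := by
  have hn : (η T x).numActive = 0 := by
    by_contra hn
    -- With an active particle at `x` forever, the clock of `x` runs at speed at least one and
    -- eventually rings past the next jump instruction, which a constant state forbids.
    obtain ⟨j, hj, z, hz⟩ := hinf (h T x)
    set c := ∑ i ∈ Finset.range (j + 1), clock x i
    -- The maximum ensures `T ≤ t`, since clock values are not assumed nonnegative here.
    set t := T + max c 0
    have ht : T ≤ t := le_add_of_nonneg_right (le_max_right _ _)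
    refine absurd (H.odometer_le_of_jump hτ hT hfix hz hj t ht) (not_le.2 ?_)
    rw [H.ring t (hT.trans ht), internalTime_eq T t hT ht x hfix]
    have h1 : (1 : ℝ≥0∞) ≤ (η T x).numActive := by exact_mod_cast Nat.one_le_iff_ne_zero.2 hn
    calc ENNReal.ofReal c ≤ 1 * 1 * ENNReal.ofReal (t - T) := by
          rw [one_mul, one_mul]
          exact ENNReal.ofReal_le_ofReal (by simp [t])
      _ ≤ _ := by
          refine le_add_left ?_
          gcongr
          exact le_self_add
  refine ⟨?_, fun t ht => ?_⟩
  · rcases hs : η T x with n | _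
    · rw [hs] at hn
      simp only [SiteState.numActive] at hn
      simp [SiteState.mass, hn]
    · rfl
  · refine le_antisymm (le_of_forall_lt fun j hj => ?_) (H.odometer_mono x hT ht)
    rw [H.ring t (hT.trans ht), internalTime_eq T t hT ht x hfix, hn] at hj
    rw [H.ring T hT]
    simpa using hj

/-- The final odometer of a locally fixating trajectory leaves at most one particle per site. -/
lemma exists_leavesAtMostOne (H : IsARWTrajectory lam e τ clock η h)
    (hτ : ∀ x j z, τ x j = Instr.jump z → z = 1 ∨ z = -1)
    (hinf : ∀ x J, ∃ j ≥ J, ∃ z, τ x j = Instr.jump z) (hfix : LocallyFixates η) :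
    ∃ m, LeavesAtMostOne e τ m := by
  choose T hT hfix using hfix
  have hsite := fun x => H.site_fixates hτ (hinf x) (hT x) (hfix x)
  refine ⟨fun x => h (T x) x, fun x => ?_⟩
  set t := max (T x) (max (T (x - 1)) (T (x + 1)))
  have hx : T x ≤ t := le_max_left _ _
  have hx1 : T (x - 1) ≤ t := (le_max_left _ _).trans (le_max_right _ _)
  have hx2 : T (x + 1) ≤ t := (le_max_right _ _).trans (le_max_right _ _)
  have hc := H.mass_add_outflow hτ x t ((hT x).trans hx)
  have h1 := (hsite x).1
  unfold inflow at hc ⊢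
  beta_reduce
  rw [(hsite x).2 t hx, (hsite _).2 t hx1, (hsite _).2 t hx2, hfix x t hx] at hc
  omega

end IsARWTrajectory

/-! ### Measurability and stationarity of the least odometer -/

/-- Since `sInf ∅ = 0`, the sublevel sets also contain all points where no `n` satisfies the
predicate. -/
lemma measurable_sInf_setOf {α : Type*} [MeasurableSpace α] {p : α → ℕ → Prop}
    (hp : ∀ n, MeasurableSet {a | p a n}) : Measurable fun a => sInf {n | p a n} := by
  refine measurable_of_Iic fun n => ?_
  have : (fun a => sInf {n | p a n}) ⁻¹' Set.Iic n =
      (⋃ j ∈ Set.Iic n, {a | p a j}) ∪ ⋂ j, {a | p a j}ᶜ := by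
    ext a
    simp only [Set.mem_preimage, Set.mem_Iic, Set.mem_union, Set.mem_iUnion, Set.mem_iInter,
      Set.mem_compl_iff, Set.mem_ofPred_eq, exists_prop]
    by_cases h : ∃ j, p a j
    · have hmem : p a (sInf {n | p a n}) := Nat.sInf_mem (s := {n | p a n}) h
      constructor
      · exact fun hle => Or.inl ⟨_, hle, hmem⟩
      · rintro (⟨j, hj, hpj⟩ | hno)
        · exact (Nat.sInf_le (s := {n | p a n}) hpj).trans hj
        · exact absurd h (not_exists.2 hno)
    · have hno := not_exists.1 h
      simp [hno]
  rw [this]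
  exact (MeasurableSet.biUnion (Set.to_countable _) fun j _ => hp j).union
    (MeasurableSet.iInter fun j => (hp j).compl)

/-- Initial configurations together with stacks of instructions. -/
abbrev ARWData : Type := (ℤ → ℕ) × (ℤ → ℕ → Instr)

lemma measurable_jumpCount (z x : ℤ) {f : ARWData → ℕ} (hf : Measurable f) :
    Measurable fun d : ARWData => jumpCount z (d.2 x) (f d) := by
  have h : Measurable fun q : ARWData × ℕ => jumpCount z (q.1.2 x) q.2 := by
    refine measurable_from_prod_countable_left fun n => ?_
    unfold jumpCount
    refine Finset.measurable_fun_sum (Finset.range n) fun i _ => ?_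
    have hm : Measurable fun d : ARWData => d.2 x i := by fun_prop
    exact Measurable.ite (hm (MeasurableSpace.measurableSet_top (s := {Instr.jump z})))
      measurable_const measurable_const
  exact h.comp (measurable_id.prodMk hf)

lemma measurable_stabIter (k : ℕ) (x : ℤ) :
    Measurable fun d : ARWData => stabIter d.1 d.2 k x := by
  induction k generalizing x with
  | zero => exact measurable_const
  | succ k ih =>
    refine measurable_sInf_setOf fun j => measurableSet_le ?_ ?_
    · have h0 : Measurable fun d : ARWData => d.1 x := by fun_prop
      exact (h0.add (measurable_jumpCount _ _ (ih _))).add (measurable_jumpCount _ _ (ih _))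
    · exact ((measurable_jumpCount _ _ measurable_const).add
        (measurable_jumpCount _ _ measurable_const)).add_const 1

/-- The supremum of the `stabIter` at a site. -/
noncomputable def stabSup (d : ARWData) (x : ℤ) : ℝ≥0∞ := ⨆ k, (stabIter d.1 d.2 k x : ℝ≥0∞)

lemma measurable_stabSup (x : ℤ) : Measurable fun d => stabSup d x :=
  Measurable.iSup fun k => Measurable.comp (g := fun n : ℕ => (n : ℝ≥0∞)) (by fun_prop)
    (measurable_stabIter k x)

/-- The data seen from the site `a`. -/
def ARWData.shift (a : ℤ) (d : ARWData) : ARWData := (fun x => d.1 (a + x), fun x => d.2 (a + x))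

lemma stabSup_shift (d : ARWData) (a x : ℤ) : stabSup (d.shift a) x = stabSup d (a + x) := by
  simp only [stabSup, ARWData.shift, stabIter_shift]

instance : Countable Instr :=
  Function.Injective.countable (f := fun i : Instr => match i with
    | .jump z => some z
    | .sleep => none) (by rintro (z | _) (w | _) <;> simp)

lemma measure_instr_ext {ν ν' : Measure Instr} (hj : ∀ z, ν {Instr.jump z} = ν' {Instr.jump z})
    (hs : ν {Instr.sleep} = ν' {Instr.sleep}) : ν = ν' := by
  have : MeasurableSingletonClass Instr := ⟨fun _ => MeasurableSpace.measurableSet_top⟩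
  refine Measure.ext_of_singleton fun i => ?_
  rcases i with z | _
  · exact hj z
  · exact hs

/-- The law of a family of i.i.d. random variables is invariant under injective reindexing. -/
lemma map_precomp_eq_of_iIndepFun {Ω ι E : Type*} [MeasurableSpace Ω] [MeasurableSpace E]
    {P : Measure Ω} {X : ι → Ω → E} (hX : ∀ i, Measurable (X i)) (hind : iIndepFun X P)
    (hlaw : ∀ i j, P.map (X i) = P.map (X j)) {g : ι → ι} (hg : g.Injective) :
    P.map (fun ω i => X (g i) ω) = P.map (fun ω i => X i ω) := by
  rw [(hind.precomp hg).map_fun_eq_infinitePi_map (fun i => hX (g i)),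
    hind.map_fun_eq_infinitePi_map hX]
  congr 1
  funext i
  exact hlaw _ _

namespace IsPoissonARW

variable {Ω : Type*} [MeasurableSpace Ω] {P : Measure Ω}
  {lam : ℝ≥0∞} {p : PMF ℤ} {μ : ℝ≥0}
  {η₀ : ℤ → Ω → ℕ} {instr : ℤ → ℕ → Ω → Instr} {clock : ℤ → ℕ → Ω → ℝ}
  {η : ℝ → Ω → Config}

lemma map_instr_eq (H : IsPoissonARW P lam p μ η₀ instr clock η) (x y : ℤ) (i j : ℕ) :
    P.map (instr x i) = P.map (instr y j) := by
  have hm := H.meas_instr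
  refine measure_instr_ext (fun z => ?_) ?_
  · rw [Measure.map_apply (hm x i) MeasurableSpace.measurableSet_top,
      Measure.map_apply (hm y j) MeasurableSpace.measurableSet_top]
    exact (H.law_jump x i z).trans (H.law_jump y j z).symm
  · rw [Measure.map_apply (hm x i) MeasurableSpace.measurableSet_top,
      Measure.map_apply (hm y j) MeasurableSpace.measurableSet_top]
    exact (H.law_sleep x i).trans (H.law_sleep y j).symm

lemma map_init_shift (H : IsPoissonARW P lam p μ η₀ instr clock η) (a : ℤ) :
    P.map (fun ω x => η₀ (a + x) ω) = P.map (fun ω x => η₀ x ω) :=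
  map_precomp_eq_of_iIndepFun H.meas_init H.indep_init
    (fun i j => (H.law_init i).trans (H.law_init j).symm) (add_right_injective a)

lemma map_instr_shift (H : IsPoissonARW P lam p μ η₀ instr clock η) (a : ℤ) :
    P.map (fun ω x j => instr (a + x) j ω) = P.map (fun ω x j => instr x j ω) := by
  have h := map_precomp_eq_of_iIndepFun (X := fun q : ℤ × ℕ => instr q.1 q.2)
    (fun q => H.meas_instr q.1 q.2) H.indep_instr (fun i j => H.map_instr_eq _ _ _ _)
    (g := fun q => (a + q.1, q.2)) (by
      rintro ⟨x, i⟩ ⟨y, j⟩ h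
      simpa using h)
  have hc : Measurable fun (f : ℤ × ℕ → Instr) (x : ℤ) (j : ℕ) => f (x, j) := by fun_prop
  have hm := H.meas_instr
  have h' := congrArg (Measure.map fun (f : ℤ × ℕ → Instr) (x : ℤ) (j : ℕ) => f (x, j)) h
  rwa [Measure.map_map hc (by fun_prop), Measure.map_map hc (by fun_prop)] at h'

/-- The joint law of the initial configuration and the instructions is translation invariant. -/
lemma map_data_shift [IsProbabilityMeasure P] (H : IsPoissonARW P lam p μ η₀ instr clock η) (a : ℤ) :
    P.map (fun ω => ARWData.shift a (fun x => η₀ x ω, fun x j => instr x j ω)) =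
      P.map (fun ω => ((fun x => η₀ x ω, fun x j => instr x j ω) : ARWData)) := by
  have hm := H.meas_init
  have hm' := H.meas_instr
  have hind : IndepFun (fun ω x => η₀ x ω) (fun ω x j => instr x j ω) P :=
    H.indep_init_rest.comp measurable_id measurable_fst
  have hind' : IndepFun (fun ω x => η₀ (a + x) ω) (fun ω x j => instr (a + x) j ω) P :=
    hind.comp (φ := fun (f : ℤ → ℕ) x => f (a + x))
      (ψ := fun (f : ℤ → ℕ → Instr) x => f (a + x)) (by fun_prop) (by fun_prop)
  have h1 := (indepFun_iff_map_prod_eq_prod_map_map (by fun_prop) (by fun_prop)).1 hind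
  have h2 := (indepFun_iff_map_prod_eq_prod_map_map (by fun_prop) (by fun_prop)).1 hind'
  rw [h1]
  rw [H.map_init_shift, H.map_instr_shift] at h2
  exact h2

/-- `stabSup` at `a` is `stabSup` at `0` of the shifted data, and these have the same law as the
original data. -/
lemma measure_stabSup_mem [IsProbabilityMeasure P] (H : IsPoissonARW P lam p μ η₀ instr clock η) {A : Set ℝ≥0∞}
    (hA : MeasurableSet A) (a : ℤ) :
    P {ω | stabSup (fun x => η₀ x ω, fun x j => instr x j ω) a ∈ A} =
      P {ω | stabSup (fun x => η₀ x ω, fun x j => instr x j ω) 0 ∈ A} := by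
  have hm := H.meas_init
  have hm' := H.meas_instr
  have hd : Measurable fun ω => ((fun x => η₀ x ω, fun x j => instr x j ω) : ARWData) := by
    fun_prop
  have hs : Measurable (ARWData.shift a) := by unfold ARWData.shift; fun_prop
  have hS := (measurable_stabSup 0) hA
  have h := congrArg (fun ν => ν ((fun d => stabSup d 0) ⁻¹' A)) (H.map_data_shift a)
  beta_reduce at h
  rw [Measure.map_apply (f := fun ω => ARWData.shift a (fun x => η₀ x ω, fun x j => instr x j ω))
    (hs.comp hd) hS, Measure.map_apply hd hS] at h
  have ha : ∀ d, stabSup d a = stabSup (d.shift a) 0 := fun d => by rw [stabSup_shift, add_zero]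
  simp only [ha]
  exact h

/-- Almost surely all jump instructions are nearest-neighbour. -/
lemma ae_jump_nearest (H : IsPoissonARW P lam p μ η₀ instr clock η)
    (hp : ∀ z : ℤ, |z| ≠ 1 → p z = 0) :
    ∀ᵐ ω ∂P, ∀ x j z, instr x j ω = Instr.jump z → z = 1 ∨ z = -1 := by
  simp only [ae_all_iff]
  intro x j z
  by_cases hz : |z| = 1
  · exact ae_of_all _ fun ω _ => eq_or_eq_neg_of_abs_eq hz
  · have h0 : P {ω | instr x j ω = Instr.jump z} = 0 := by simp [H.law_jump, hp z hz]
    filter_upwards [measure_eq_zero_iff_ae_notMem.1 h0] with ω h1 h2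
    exact absurd h2 h1

/-- Almost surely every stack has infinitely many jump instructions. -/
lemma ae_infinite_jumps [IsProbabilityMeasure P] (H : IsPoissonARW P lam p μ η₀ instr clock η) :
    ∀ᵐ ω ∂P, ∀ x J, ∃ j ≥ J, ∃ z, instr x j ω = Instr.jump z := by
  rw [ae_all_iff]
  intro x
  obtain ⟨z, hz⟩ : ∃ z, p z ≠ 0 := p.support_nonempty
  set s : ℕ → Set Ω := fun j => {ω | instr x j ω = Instr.jump z}
  have hms : MeasurableSet ({Instr.jump z} : Set Instr) := MeasurableSpace.measurableSet_top
  have hm : ∀ j, MeasurableSet (s j) := fun j => H.meas_instr x j hms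
  have hind : iIndepFun (fun j => instr x j) P :=
    H.indep_instr.precomp (g := fun j => (x, j)) fun i j h => by simpa using h
  have hs : iIndepSet s P := by
    rw [iIndepSet_iff_meas_biInter hm]
    intro t
    exact (iIndepFun_iff_measure_inter_preimage_eq_mul.1 hind) t fun _ _ => hms
  -- A finite rate, also for `lam = ∞`, keeps the jump probability positive, as the second
  -- Borel–Cantelli lemma requires.
  have hrate : sleepClockRate lam ≠ ∞ := by
    unfold sleepClockRate
    split_ifs with h
    · simp
    · exact h
  have hsum : ∑' j, P (s j) = ∞ := by
    have : ∀ j, P (s j) = p z / (1 + sleepClockRate lam) := fun j => H.law_jump x j z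
    simp only [this]
    exact ENNReal.tsum_const_eq_top_of_ne_zero
      (ENNReal.div_ne_zero.2 ⟨hz, ENNReal.add_ne_top.2 ⟨ENNReal.one_ne_top, hrate⟩⟩)
  have h1 := measure_limsup_eq_one hm hs hsum
  have h2 : ∀ᵐ ω ∂P, ω ∈ limsup s atTop :=
    (prob_compl_eq_zero_iff (MeasurableSet.measurableSet_limsup hm)).2 h1
  filter_upwards [h2] with ω hω J
  rw [mem_limsup_iff_frequently_mem] at hω
  obtain ⟨j, hj, hω⟩ := frequently_atTop.1 hω J
  exact ⟨j, hj, z, hω⟩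

end IsPoissonARW

/-! ### Block sums of independent variables -/

/-- If the sum over each block of length `n` reaches `c` with probability at least `δ`, then it
does so in one of the first `K` blocks except with probability `(1 - δ) ^ K`. -/
lemma measure_forall_block_sum_lt_le {Ω : Type*} [MeasurableSpace Ω] {P : Measure Ω}
    [IsProbabilityMeasure P] {X : ℕ → Ω → ℕ} (hX : ∀ i, Measurable (X i)) (hind : iIndepFun X P)
    {n c : ℕ} {δ : ℝ≥0∞}
    (hδ : ∀ i, δ ≤ P {ω | c ≤ ∑ k ∈ Finset.range n, X (i * n + k) ω}) (K : ℕ) :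
    P {ω | ∀ i < K, ∑ k ∈ Finset.range n, X (i * n + k) ω < c} ≤ (1 - δ) ^ K := by
  induction K with
  | zero => simp
  | succ K ih =>
    set S := Finset.range (K * n)
    set T := Finset.Ico (K * n) (K * n + n)
    have hST : Disjoint S T := by
      rw [Finset.disjoint_left]
      intro i hi hi'
      simp only [S, T, Finset.mem_range, Finset.mem_Ico] at hi hi'
      omega
    have hi := hind.indepFun_finset S T hST hX
    -- Extension by zero expresses the event of the first `K` blocks through the coordinates in `S`
    -- only.
    set g : (S → ℕ) → ℕ → ℕ := fun f i => if h : i ∈ S then f ⟨i, h⟩ else 0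
    have hA : {ω | ∀ i < K, ∑ k ∈ Finset.range n, X (i * n + k) ω < c} =
        (fun ω (i : S) => X i ω) ⁻¹' {f | ∀ i < K, ∑ k ∈ Finset.range n, g f (i * n + k) < c} := by
      ext ω
      simp only [Set.mem_ofPred_eq, Set.mem_preimage]
      refine forall₂_congr fun i hi => ?_
      rw [Finset.sum_congr rfl fun k hk => ?_]
      have : i * n + k ∈ S := by
        simp only [S, Finset.mem_range] at hk ⊢
        nlinarith
      simp [g, this]
    have hB : {ω | ∑ k ∈ Finset.range n, X (K * n + k) ω < c} =
        (fun ω (i : T) => X i ω) ⁻¹' {f | ∑ i, f i < c} := by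
      ext ω
      simp only [Set.mem_ofPred_eq, Set.mem_preimage]
      rw [Finset.sum_coe_sort T fun i => X i ω, Finset.sum_Ico_eq_sum_range, add_tsub_cancel_left]
    have hsplit : {ω | ∀ i < K + 1, ∑ k ∈ Finset.range n, X (i * n + k) ω < c} =
        {ω | ∀ i < K, ∑ k ∈ Finset.range n, X (i * n + k) ω < c} ∩
          {ω | ∑ k ∈ Finset.range n, X (K * n + k) ω < c} := by
      ext ω
      simp only [Set.mem_ofPred_eq, Set.mem_inter_iff, Nat.lt_succ_iff_lt_or_eq, or_imp,
        forall_and, forall_eq]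
    have hBle : P {ω | ∑ k ∈ Finset.range n, X (K * n + k) ω < c} ≤ 1 - δ := by
      have hc : {ω | ∑ k ∈ Finset.range n, X (K * n + k) ω < c} =
          {ω | c ≤ ∑ k ∈ Finset.range n, X (K * n + k) ω}ᶜ := by
        ext ω; simp
      rw [hc, prob_compl_eq_one_sub
        (measurableSet_le measurable_const (Finset.measurable_fun_sum _ fun _ _ => hX _))]
      exact tsub_le_tsub_left (hδ K) 1
    rw [hsplit, hA, hB, hi.measure_inter_preimage_eq_mul _ _ .of_discrete .of_discrete, ← hA, ← hB,
      pow_succ]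
    exact mul_le_mul' ih hBle

/-- The deviations of a sum of `n` i.i.d. variables above its mean exceed `√n` with probability
bounded below. -/
lemma exists_eventually_le_measure_sum {Ω : Type*} [MeasurableSpace Ω] {P : Measure Ω}
    [IsProbabilityMeasure P] {X : ℕ → Ω → ℝ} (hL2 : MemLp (X 0) 2 P) (hvar : Var[X 0; P] ≠ 0)
    (hind : iIndepFun X P) (hident : ∀ i, IdentDistrib (X i) (X 0) P P) :
    ∃ δ : ℝ≥0∞, 0 < δ ∧ ∀ᶠ n : ℕ in atTop,
      δ ≤ P {ω | √n + n * P[X 0] ≤ ∑ k ∈ Finset.range n, X k ω} := by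
  set v := Var[X 0; P].toNNReal
  have hv : v ≠ 0 := by
    have := (variance_nonneg (X 0) P).lt_of_ne' hvar
    exact (Real.toNNReal_pos.2 this).ne'
  have hclt := tendstoInDistribution_inv_sqrt_mul_sum_sub (P' := gaussianReal 0 v)
    (Y := id) ⟨aemeasurable_id, Measure.map_id⟩ hL2 hind hident
  have hpos : 0 < gaussianReal 0 v (Set.Ioi 1) := by
    rw [pos_iff_ne_zero]
    intro h0
    have := gaussianReal_absolutelyContinuous' 0 hv h0
    simp at this
  -- Portmanteau for the open set `(1, ∞)`: exceeding `1` after division by `√n` is an excess of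
  -- `√n` before it. Any `δ` strictly below the Gaussian mass works for large `n`.
  have hlim := ProbabilityMeasure.le_liminf_measure_open_of_tendsto hclt.tendsto
    (isOpen_Ioi (a := (1 : ℝ)))
  simp only [ProbabilityMeasure.coe_mk, Measure.map_id] at hlim
  obtain ⟨δ, hδ0, hδ⟩ := exists_between hpos
  refine ⟨δ, hδ0, ?_⟩
  filter_upwards [eventually_lt_of_lt_liminf (hδ.trans_le hlim), eventually_gt_atTop 0]
    with n hn hn0
  rw [Measure.map_apply_of_aemeasurable (hclt.forall_aemeasurable n) measurableSet_Ioi] at hn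
  refine hn.le.trans (measure_mono fun ω hω => ?_)
  have hs : 0 < √(n : ℝ) := Real.sqrt_pos.2 (by exact_mod_cast hn0)
  simp only [Set.mem_preimage, Set.mem_Ioi, Set.mem_ofPred_eq] at hω ⊢
  rw [inv_mul_eq_div, lt_div_iff₀ hs] at hω
  linarith

/-- All factorial moments of the Poisson law of mean one equal one: the terms below `k` vanish, and
shifting by `k` leaves the total mass. -/
lemma hasSum_poisson_one_descFactorial (k : ℕ) :
    HasSum (fun n : ℕ => Real.exp (-1) * 1 ^ n / n.factorial * (n.descFactorial k : ℝ)) 1 := by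
  rw [← hasSum_nat_add_iff' k]
  have h0 : ∑ i ∈ Finset.range k,
      Real.exp (-1) * 1 ^ i / i.factorial * (i.descFactorial k : ℝ) = 0 :=
    Finset.sum_eq_zero fun i hi => by
      simp [Nat.descFactorial_eq_zero_iff_lt.2 (Finset.mem_range.1 hi)]
  rw [h0, sub_zero]
  have h := hasSum_one_poissonMeasure 1
  simp only [NNReal.coe_one] at h
  refine (congrArg (HasSum · 1) (funext fun n => ?_)).mpr h
  have h1 : ((n + k).factorial : ℝ) = n.factorial * ((n + k).descFactorial k : ℝ) := by
    have := Nat.factorial_mul_descFactorial (Nat.le_add_left k n)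
    rw [Nat.add_sub_cancel] at this
    exact_mod_cast this.symm
  have h2 : ((n + k).descFactorial k : ℝ) ≠ 0 := by
    have := (n + k).factorial_ne_zero
    intro h3
    rw [h3, mul_zero] at h1
    exact this (by exact_mod_cast h1)
  have h3 : (n.factorial : ℝ) ≠ 0 := by exact_mod_cast n.factorial_ne_zero
  rw [h1]
  field_simp
  simp

section
variable {Ω : Type*} [MeasurableSpace Ω] {P : Measure Ω} {X : Ω → ℕ}

lemma integral_comp_of_map_poisson (hX : Measurable X) (hlaw : P.map X = poissonMeasure 1)
    (f : ℕ → ℝ) {a : ℝ}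
    (hf : HasSum (fun n : ℕ => Real.exp (-1) * 1 ^ n / n.factorial * f n) a) (hf0 : 0 ≤ f) :
    Integrable (fun ω => f (X ω)) P ∧ ∫ ω, f (X ω) ∂P = a := by
  have hint : Integrable f (poissonMeasure 1) := by
    rw [integrable_poissonMeasure_iff]
    convert hf.summable using 3 with n
    · simp
    · exact Real.norm_of_nonneg (hf0 n)
  constructor
  · rw [← hlaw] at hint
    exact hint.comp_measurable hX
  · rw [← integral_map (φ := X) hX.aemeasurable (f := f) .of_discrete, hlaw,
      integral_poissonMeasure]
    simpa using hf.tsum_eq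

lemma moments_of_map_poisson_one [IsProbabilityMeasure P] (hX : Measurable X)
    (hlaw : P.map X = poissonMeasure 1) :
    MemLp (fun ω => (X ω : ℝ)) 2 P ∧ P[fun ω => (X ω : ℝ)] = 1 ∧
      Var[fun ω => (X ω : ℝ); P] ≠ 0 := by
  have h1 := integral_comp_of_map_poisson hX hlaw (fun n => (n : ℝ)) (a := 1)
    (by simpa using hasSum_poisson_one_descFactorial 1) (fun n => Nat.cast_nonneg n)
  have h2 := integral_comp_of_map_poisson hX hlaw (fun n => (n : ℝ) ^ 2) (a := 1 + 1)
    (by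
      -- The second moment comes from n² = n(n - 1) + n.
      convert (hasSum_poisson_one_descFactorial 2).add (hasSum_poisson_one_descFactorial 1)
        using 2 with n
      rw [← mul_add]
      congr 1
      rcases n with _ | n
      · simp
      · simp [Nat.descFactorial_succ]
        ring) (fun n => sq_nonneg _)
  have hmem : MemLp (fun ω => (X ω : ℝ)) 2 P :=
    (memLp_two_iff_integrable_sq (by fun_prop)).2 h2.1
  refine ⟨hmem, h1.2, ?_⟩
  rw [variance_eq_sub hmem]
  have h3 : P[(fun ω => (X ω : ℝ)) ^ 2] = 1 + 1 := h2.2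
  rw [h3, h1.2]
  norm_num

end

/-! ### Excess blocks against tightness -/

namespace IsPoissonARW

variable {Ω : Type*} [MeasurableSpace Ω] {P : Measure Ω} [IsProbabilityMeasure P]
  {lam : ℝ≥0∞} {p : PMF ℤ}
  {η₀ : ℤ → Ω → ℕ} {instr : ℤ → ℕ → Ω → Instr} {clock : ℤ → ℕ → Ω → ℝ}
  {η : ℝ → Ω → Config}

/-- Tightness of the finite part of `stabSup`. -/
lemma tendsto_measure_stabSup {μ : ℝ≥0} (H : IsPoissonARW P lam p μ η₀ instr clock η) :
    Tendsto (fun M : ℕ =>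
      P {ω | stabSup (fun x => η₀ x ω, fun x j => instr x j ω) 0 ∈ Set.Ico (M : ℝ≥0∞) ∞})
      atTop (𝓝 0) := by
  have hm := H.meas_init
  have hm' := H.meas_instr
  have hs : Measurable fun ω =>
      stabSup ((fun x => η₀ x ω, fun x j => instr x j ω) : ARWData) 0 :=
    (measurable_stabSup 0).comp (by fun_prop)
  have h := tendsto_measure_iInter_atTop (μ := P) (s := fun M : ℕ =>
      {ω | stabSup (fun x => η₀ x ω, fun x j => instr x j ω) 0 ∈ Set.Ico (M : ℝ≥0∞) ∞})
    (fun M => (hs measurableSet_Ico).nullMeasurableSet)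
    (fun M N hMN ω hω => ⟨(Nat.cast_le.2 hMN).trans hω.1, hω.2⟩) ⟨0, measure_ne_top _ _⟩
  rwa [show (⋂ M : ℕ,
    {ω | stabSup (fun x => η₀ x ω, fun x j => instr x j ω) 0 ∈ Set.Ico (M : ℝ≥0∞) ∞}) = ∅ from ?_,
    measure_empty] at h
  -- Excluding the value `∞` makes the intersection empty, even though `stabSup` may be infinite off
  -- the fixation event.
  refine Set.eq_empty_of_forall_notMem fun ω hω => ?_
  rw [Set.mem_iInter] at hω
  obtain ⟨M, hM⟩ := ENNReal.exists_nat_gt (hω 0).2.ne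
  exact absurd (hω M).1 (not_le.2 hM)

/-- At density one, blocks of initial particles exceed their mean by any given amount with
probability bounded below. -/
lemma exists_le_measure_block (H : IsPoissonARW P lam p 1 η₀ instr clock η) :
    ∃ δ : ℝ≥0∞, 0 < δ ∧ ∀ M : ℕ, ∃ n : ℕ, ∀ a : ℤ,
      δ ≤ P {ω | n + 2 * M ≤ ∑ k ∈ Finset.range n, η₀ (a + k) ω} := by
  have hm := H.meas_init
  have hind : iIndepFun (fun (k : ℕ) ω => (η₀ k ω : ℝ)) P :=
    (H.indep_init.precomp (g := fun k : ℕ => (k : ℤ)) Nat.cast_injective).comp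
      (fun _ n => (n : ℝ)) (fun _ => by fun_prop)
  have hident : ∀ k : ℕ, IdentDistrib (fun ω => (η₀ k ω : ℝ)) (fun ω => (η₀ (0 : ℕ) ω : ℝ)) P P :=
    fun k => IdentDistrib.comp (u := fun n : ℕ => (n : ℝ))
      ⟨(hm _).aemeasurable, (hm _).aemeasurable, (H.law_init _).trans (H.law_init _).symm⟩
      (by fun_prop)
  obtain ⟨h1, h2, h3⟩ := moments_of_map_poisson_one (hm (0 : ℕ)) (H.law_init _)
  obtain ⟨δ, hδ, hev⟩ := exists_eventually_le_measure_sum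
    (X := fun (k : ℕ) ω => (η₀ k ω : ℝ)) h1 h3 hind hident
  refine ⟨δ, hδ, fun M => ?_⟩
  -- This size gives `2 * M ≤ √n`; only `n` depends on `M`, not `δ`.
  obtain ⟨n, hn, hnM⟩ := (hev.and (eventually_ge_atTop ((2 * M) ^ 2))).exists
  refine ⟨n, fun a => ?_⟩
  set A : Set (ℤ → ℕ) := {f | n + 2 * M ≤ ∑ k ∈ Finset.range n, f k}
  have hA : MeasurableSet A :=
    measurableSet_le measurable_const (Finset.measurable_fun_sum _ fun _ _ => by fun_prop)
  have hshift := congrArg (fun ν => ν A) (H.map_init_shift a)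
  beta_reduce at hshift
  rw [Measure.map_apply (by fun_prop) hA, Measure.map_apply (by fun_prop) hA] at hshift
  refine (hn.trans (measure_mono fun ω hω => ?_)).trans hshift.ge
  simp only [h2, Set.mem_ofPred_eq, mul_one, Set.mem_preimage, A] at hω ⊢
  have hsq : (2 * M : ℝ) ≤ √(n : ℝ) := Real.le_sqrt_of_sq_le (by exact_mod_cast hnM)
  have : (n + 2 * M : ℝ) ≤ ∑ k ∈ Finset.range n, (η₀ k ω : ℝ) := by linarith
  exact_mod_cast this

/-- On the event of fixation, a large excess of particles in a block forces a large odometer at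
one of its end points. -/
lemma ae_stabSup_mem_of_block (H : IsPoissonARW P lam p 1 η₀ instr clock η)
    (hp : ∀ z : ℤ, |z| ≠ 1 → p z = 0) :
    ∀ᵐ ω ∂P, LocallyFixates (fun t => η t ω) → ∀ (a : ℤ) (n M : ℕ),
      n + 2 * M ≤ ∑ k ∈ Finset.range n, η₀ (a + k) ω →
      stabSup (fun x => η₀ x ω, fun x j => instr x j ω) a ∈ Set.Ico (M : ℝ≥0∞) ∞ ∨
      stabSup (fun x => η₀ x ω, fun x j => instr x j ω) (a + n - 1) ∈ Set.Ico (M : ℝ≥0∞) ∞ := by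
  filter_upwards [H.trajectory, H.ae_jump_nearest hp, H.ae_infinite_jumps] with ω hω h1 h2 hfix
    a n M hM
  obtain ⟨h, hh⟩ := hω
  obtain ⟨m, hm⟩ := hh.exists_leavesAtMostOne h1 h2 hfix
  obtain ⟨m', hm', hlim⟩ := hm.exists_limit
  have hle := hm'.block_sum_le a n
  unfold stabSup
  simp only [hlim, Set.mem_Ico, ENNReal.natCast_lt_top, and_true, Nat.cast_le]
  omega

end IsPoissonARW

theorem mainTheorem3 {Ω : Type*} [MeasurableSpace Ω] (P : Measure Ω) [IsProbabilityMeasure P]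
    (lam : ℝ≥0∞) (hlam : 0 < lam)
    (p : PMF ℤ) (hp : ∀ z : ℤ, |z| ≠ 1 → p z = 0)
    (η₀ : ℤ → Ω → ℕ) (instr : ℤ → ℕ → Ω → Instr) (clock : ℤ → ℕ → Ω → ℝ)
    (η : ℝ → Ω → Config)
    (hη : IsPoissonARW P lam p 1 η₀ instr clock η) :
    ∀ᵐ ω ∂P, ¬ LocallyFixates (fun t => η t ω) := by
  set B : ℕ → ℤ → Set Ω := fun M a =>
    {ω | stabSup (fun x => η₀ x ω, fun x j => instr x j ω) a ∈ Set.Ico (M : ℝ≥0∞) ∞}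
  have hB : ∀ M a, P (B M a) = P (B M 0) := fun M a => hη.measure_stabSup_mem measurableSet_Ico a
  have hlimB : Tendsto (fun M => P (B M 0)) atTop (𝓝 0) := hη.tendsto_measure_stabSup
  obtain ⟨δ, hδ, hblock⟩ := hη.exists_le_measure_block
  set F : Set Ω := {ω | LocallyFixates (fun t => η t ω)}
  have hbound : ∀ K M : ℕ, P F ≤ (1 - δ) ^ K + K * (P (B M 0) + P (B M 0)) := by
    intro K M
    obtain ⟨n, hn⟩ := hblock M
    have hK := measure_forall_block_sum_lt_le (X := fun k : ℕ => η₀ k) (fun k => hη.meas_init k)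
      (hη.indep_init.precomp (g := fun k : ℕ => (k : ℤ)) Nat.cast_injective)
      (n := n) (c := n + 2 * M) (δ := δ) (fun i => by simpa using hn (i * n)) K
    set G : Set Ω := {ω | ∀ i < K, ∑ k ∈ Finset.range n, η₀ ((i * n + k : ℕ) : ℤ) ω < n + 2 * M}
    set U : ℕ → Set Ω := fun i => B M (i * n) ∪ B M (i * n + n - 1)
    -- Either none of the `K` blocks has excess `2 * M`, or fixation puts a large finite odometer at
    -- an end of one that does. Only monotonicity and subadditivity are applied to `F`, so its
    -- measurability is not needed.
    have hsub : F ≤ᵐ[P] (G ∪ ⋃ i ∈ Finset.range K, U i : Set Ω) := by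
      filter_upwards [hη.ae_stabSup_mem_of_block hp] with ω hω hF
      by_cases hG : ω ∈ G
      · exact Or.inl hG
      · right
        simp only [G, Set.mem_ofPred_eq, not_forall, not_lt] at hG
        obtain ⟨i, hi, hle⟩ := hG
        simp only [Set.mem_iUnion]
        exact ⟨i, Finset.mem_range.2 hi, hω hF (i * n) n M (by simpa using hle)⟩
    calc P F ≤ P (G ∪ ⋃ i ∈ Finset.range K, U i) := measure_mono_ae hsub
      _ ≤ P G + P (⋃ i ∈ Finset.range K, U i) := measure_union_le _ _
      _ ≤ P G + ∑ i ∈ Finset.range K, P (U i) := by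
        gcongr
        exact measure_biUnion_finset_le _ _
      _ ≤ (1 - δ) ^ K + ∑ i ∈ Finset.range K, (P (B M 0) + P (B M 0)) := by
        gcongr with i hi
        refine (measure_union_le _ _).trans ?_
        rw [hB M (i * n), hB M (i * n + n - 1)]
      _ = (1 - δ) ^ K + K * (P (B M 0) + P (B M 0)) := by simp [mul_add]
  have hpow : ∀ K : ℕ, P F ≤ (1 - δ) ^ K := by
    intro K
    -- The block length grows with `M`, but by stationarity the bound depends only on the law at one
    -- site, so `M → ∞` is allowed for fixed `K`.
    have h : Tendsto (fun M => (1 - δ) ^ K + K * (P (B M 0) + P (B M 0))) atTop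
        (𝓝 ((1 - δ) ^ K + K * (0 + 0))) :=
      (ENNReal.Tendsto.const_mul (hlimB.add hlimB) (Or.inr (ENNReal.natCast_ne_top K))).const_add _
    simpa using ge_of_tendsto' h (hbound K)
  have hF : P F = 0 := by
    have h1 : 1 - δ < 1 := ENNReal.sub_lt_self ENNReal.one_ne_top one_ne_zero hδ.ne'
    exact le_antisymm (ge_of_tendsto' (ENNReal.tendsto_pow_atTop_nhds_zero_of_lt_one h1) hpow)
      zero_le
  exact measure_eq_zero_iff_ae_notMem.1 hF
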